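/- Let $n,t,k$ be natural numbers with $n/2\le t\le k<n-1$. Consider $n$ asynchronous sequential processes $p_1,\dots,p_n$, of which up to $t$ may crash, that communicate through any number of arrays of single-writer multi-reader atomic registers (entry $i$ of an array is written only by $p_i$ and read by all) and any number of one-shot $k$-immediate snapshot ($k$-IS) objects. A $k$-IS object provides one operation $\mathsf{write\_snapshot}_k(u)$, which each process invokes at most once; an invocation by $p_i$ returns a set $view_i$ of pairs $\langle j,u_j\rangle$ such that, at all times: - (Self-inclusion) $view_i$ contains the pair $\langle i,u\rangle$ written by $p_i$; - (Validity) if $\langle j,u\rangle\in view_i$, then $p_j$ has invoked $\mathsf{write\_snapshot}_k(u)$; - (Containment) $view_i\subseteq view_j$ or $view_j\subseteq view_i$ for any two returned views; - (Immediacy) if $view_i$ and $view_j$ have been returned and $\langle i,u\rangle\in view_j$, then $view_i\subseteq view_j$; - (Output size) $|view_i|\ge n-k$; and moreover (Termination) if at least $n-k$ processes invoke the object in a run, then every invocation of it by a correct process returns. An algorithm implements consensus over a set $V$ of values in this model if, for all proposed values $v_1,\dots,v_n\in V$ and in every run with at most $t$ crashes, every correct process decides (termination), every decided value is one of the proposed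 values (validity), and no two decided values differ (agreement). Then, for every set $V$ with at least two elements, no algorithm (with arbitrary sets of local states, registers, register values, $k$-IS objects and values written to them) implements consensus over $V$ in this model. -/

import Mathlib

namespace CrashModel

/-- The next operation of a process whose local states form `S`, together with the local state that
follows, as a function of the value returned by the operation if there is one (local computation is
part of that function). Process `j` owns the entry `j` of every register array `r : R`. -/
inductive Op (n : ℕ) (V R W O U S : Type*) where
  /-- read the register owned by process `j` in the array `r` -/
  | read (r : R) (j : Fin n) (cont : W → S)
  /-- write `w` in the register that the executing process owns in the array `r` -/
  | write (r : R) (w : W) (cont : S)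
  /-- invoke `write_snapshot` with the value `u` on the snapshot object `o` -/
  | snapshot (o : O) (u : U) (cont : Finset (Fin n × U) → S)
  /-- decide `v`; the process may go on afterwards -/
  | decide (v : V) (cont : S)

/-- A deterministic algorithm for `n` sequential processes that propose and decide values in `V`.
The shared memory consists of arrays, indexed by `R`, of `n` single-writer multi-reader registers
with values in `W`, and of snapshot objects, indexed by `O`, to which values in `U` are written. -/
structure Algorithm (n : ℕ) (V R W O U S : Type*) where
  /-- initial value of every register -/
  regInit : R → Fin n → W
  /-- initial local state of a process, given the value it proposes -/
  init : Fin n → V → S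
  /-- the operation that a process executes next in a given local state -/
  next : Fin n → S → Op n V R W O U S

/-- A global state: local states, register contents, and for every snapshot object and every process
the value the process has written to it (`none` before the invocation) and the view it has obtained
from it (`none` before the response). -/
structure GlobalState (n : ℕ) (R W O U S : Type*) where
  loc : Fin n → S
  mem : R → Fin n → W
  inv : O → Fin n → Option U
  view : O → Fin n → Option (Finset (Fin n × U))

/-- What happens at one instant: nothing, process `i` executes its next operation (for a snapshot
object: its invocation), or process `i` obtains the view `X` as response to its pending
invocation. -/
inductive Event (n : ℕ) (U : Type*) where
  | idle
  | step (i : Fin n)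
  | respond (i : Fin n) (X : Finset (Fin n × U))

/-- The event is an event of process `i`. -/
def Event.IsBy {n : ℕ} {U : Type*} (i : Fin n) : Event n U → Prop
  | .idle => False
  | .step j => j = i
  | .respond j _ => j = i

/-- The safety properties of a one-shot `k`-immediate snapshot object among `n` processes, where
`inv i` is the value with which process `i` has invoked the object and `view i` is the view it has
obtained, if any. -/
structure IsKImmediateSnapshot {n : ℕ} {U : Type*} (k : ℕ) (inv : Fin n → Option U)
    (view : Fin n → Option (Finset (Fin n × U))) : Prop where
  self_inclusion : ∀ i X, view i = some X → ∃ u, inv i = some u ∧ (i, u) ∈ X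
  validity : ∀ i X, view i = some X → ∀ j u, (j, u) ∈ X → inv j = some u
  containment : ∀ i j X Y, view i = some X → view j = some Y → X ⊆ Y ∨ Y ⊆ X
  immediacy : ∀ i j X Y u, view i = some X → view j = some Y → (i, u) ∈ Y → X ⊆ Y
  output_size : ∀ i X, view i = some X → n ≤ X.card + k

namespace GlobalState

variable {n : ℕ} {R W O U S : Type*}

/-- Process `i` has invoked the object `o` and has not obtained its view yet. -/
def Inside (c : GlobalState n R W O U S) (i : Fin n) (o : O) : Prop :=
  c.inv o i ≠ none ∧ c.view o i = none

/-- Process `i` is waiting for a response of a snapshot object. -/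
def Waiting (c : GlobalState n R W O U S) (i : Fin n) : Prop :=
  ∃ o, c.Inside i o

end GlobalState

namespace Algorithm

variable {n : ℕ} {V R W O U S : Type*}

/-- The initial global state when process `i` proposes `input i`. -/
def initial (A : Algorithm n V R W O U S) (input : Fin n → V) : GlobalState n R W O U S where
  loc i := A.init i (input i)
  mem := A.regInit
  inv _ _ := none
  view _ _ := none

open Classical in
/-- `A.Trans c e c'`: the event `e` can lead from `c` to `c'`. The views are unconstrained here. -/
inductive Trans (A : Algorithm n V R W O U S) :
    GlobalState n R W O U S → Event n U → GlobalState n R W O U S → Prop where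
  | idle (c) : A.Trans c .idle c
  | read (c) (i : Fin n) (r : R) (j : Fin n) (cont : W → S)
      (hw : ¬ c.Waiting i) (hop : A.next i (c.loc i) = .read r j cont) :
      A.Trans c (.step i) { c with loc := Function.update c.loc i (cont (c.mem r j)) }
  | write (c) (i : Fin n) (r : R) (w : W) (cont : S)
      (hw : ¬ c.Waiting i) (hop : A.next i (c.loc i) = .write r w cont) :
      A.Trans c (.step i)
        { c with
          loc := Function.update c.loc i cont
          mem := Function.update c.mem r (Function.update (c.mem r) i w) }
  | decide (c) (i : Fin n) (v : V) (cont : S)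
      (hw : ¬ c.Waiting i) (hop : A.next i (c.loc i) = .decide v cont) :
      A.Trans c (.step i) { c with loc := Function.update c.loc i cont }
  | invoke (c) (i : Fin n) (o : O) (u : U) (cont : Finset (Fin n × U) → S)
      (hw : ¬ c.Waiting i) (hop : A.next i (c.loc i) = .snapshot o u cont)
      (hone : c.inv o i = none) :
      A.Trans c (.step i)
        { c with inv := Function.update c.inv o (Function.update (c.inv o) i (some u)) }
  | respond (c) (i : Fin n) (o : O) (u : U) (cont : Finset (Fin n × U) → S)
      (X : Finset (Fin n × U))
      (hin : c.Inside i o) (hop : A.next i (c.loc i) = .snapshot o u cont) :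
      A.Trans c (.respond i X)
        { c with
          loc := Function.update c.loc i (cont X)
          view := Function.update c.view o (Function.update (c.view o) i (some X)) }

/-- `c` and `e` are the global states and the events of an execution of `A` in which the snapshot
objects satisfy the safety properties of `k`-immediate snapshot at all times. -/
structure IsExecution (A : Algorithm n V R W O U S) (k : ℕ) (input : Fin n → V)
    (c : ℕ → GlobalState n R W O U S) (e : ℕ → Event n U) : Prop where
  start : c 0 = A.initial input
  trans : ∀ s, A.Trans (c s) (e s) (c (s + 1))
  safe : ∀ s o, IsKImmediateSnapshot k ((c s).inv o) ((c s).view o)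

/-- A run of `A` in the asynchronous model in which the processes of `faulty`, at most `t` many,
crash, enriched with `k`-immediate snapshot objects. -/
structure IsRun (A : Algorithm n V R W O U S) (t k : ℕ) (input : Fin n → V)
    (c : ℕ → GlobalState n R W O U S) (e : ℕ → Event n U) (faulty : Finset (Fin n)) : Prop
    extends A.IsExecution k input c e where
  card_faulty : faulty.card ≤ t
  /-- a faulty process stops at some time -/
  crash : ∀ i ∈ faulty, ∃ s, ∀ s', s ≤ s' → ¬ (e s').IsBy i
  /-- a correct process takes infinitely many steps, unless it waits forever for a response -/
  progress : ∀ i ∉ faulty, ∀ s, ∃ s', s ≤ s' ∧ ((e s').IsBy i ∨ (c s').Waiting i)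
  /-- Termination of the snapshot objects: if at least `n - k` processes invoke an object (without
  which no view of the required size exists), every invocation of it by a correct process
  returns. -/
  response : ∀ o, n ≤ {i | ∃ s, (c s).inv o i ≠ none}.ncard + k →
    ∀ i ∉ faulty, (∃ s, (c s).inv o i ≠ none) → ∃ s, (c s).view o i ≠ none

/-- No process ever attempts to invoke the same snapshot object a second time. -/
def OneShot (A : Algorithm n V R W O U S) (k : ℕ) : Prop :=
  ∀ input c e, A.IsExecution k input c e →
    ∀ s i o u cont, ¬ (c s).Waiting i → A.next i ((c s).loc i) = .snapshot o u cont →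
      (c s).inv o i = none

/-- Process `i` decides `v` at some time of the execution given by `c` and `e`. -/
def Decides (A : Algorithm n V R W O U S) (c : ℕ → GlobalState n R W O U S)
    (e : ℕ → Event n U) (i : Fin n) (v : V) : Prop :=
  ∃ s cont, e s = .step i ∧ A.next i ((c s).loc i) = .decide v cont

/-- `A` uses every snapshot object in the one-shot way and implements consensus in the `t`-crash
`n`-process read/write model enriched with `k`-immediate snapshot objects. -/
structure ImplementsConsensus (A : Algorithm n V R W O U S) (t k : ℕ) : Prop where
  one_shot : A.OneShot k
  termination : ∀ input c e faulty, A.IsRun t k input c e faulty →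
    ∀ i ∉ faulty, ∃ v, A.Decides c e i v
  validity : ∀ input c e faulty, A.IsRun t k input c e faulty →
    ∀ i v, A.Decides c e i v → ∃ j, v = input j
  agreement : ∀ input c e faulty, A.IsRun t k input c e faulty →
    ∀ i j v w, A.Decides c e i v → A.Decides c e j w → v = w

end Algorithm

end CrashModel

/-! The proof is a bivalence argument in the style of Fischer, Lynch and Paterson, with an adversary
that also chooses the views. The views are fixed as soon as an object is obliged to respond (`asg`),
long before they are delivered. The adversary may later revise the assignments of at most `t`
processes (`Reassign`), provided that views already returned are kept and the object specification
still holds.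

Two states that differ only for a set of at most `t` processes share a possible decision: crash that
set and run the others, which cannot tell the states apart (`decisions_inter_nonempty`).

The critical case is that of two processes invoking the same object. Either order can be reassigned
to the outcome of a simultaneous invocation, because only `max 1 (n - k) ≤ t` processes are affected
(`exists_assign_assign_eq`, `reassign_of_invoke_invoke`). Hence the order of two steps never settles
the decision (`decisions_step_step`).

It follows that from a bivalent state any given process can be made to step while bivalence persists
(`exists_nontrivial`). Starting from a bivalent initial state, this yields a fair crash-free run
through bivalent states only (`exists_fair_sequence`, `exists_isRun`), where a decision contradicts
agreement. -/

namespace CrashModel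

/-! ### Assigning views to the invocations of one object. -/

section Assignments

variable {n : ℕ} {U : Type*}

/-- The pairs of processes that have invoked a snapshot object and values they have written. -/
def invocations (inv : Fin n → Option U) : Finset (Fin n × U) :=
  Finset.univ.filterMap (fun i => (inv i).map (Prod.mk i)) (by
    intro i j x hi hj
    simp only [Option.mem_def, Option.map_eq_some_iff] at hi hj
    obtain ⟨u, -, rfl⟩ := hi
    obtain ⟨w, -, h⟩ := hj
    exact (congrArg Prod.fst h).symm)

@[simp]
theorem mem_invocations {inv : Fin n → Option U} {i : Fin n} {u : U} :
    (i, u) ∈ invocations inv ↔ inv i = some u := by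
  simp [invocations]

theorem card_invocations (inv : Fin n → Option U) :
    (invocations inv).card = {i | inv i ≠ none}.ncard := by
  classical
  have h : {i | inv i ≠ none} = ((invocations inv).image Prod.fst : Finset (Fin n)) := by
    ext i
    simp [Option.ne_none_iff_exists']
  rw [h, Set.ncard_coe_finset, Finset.card_image_of_injOn]
  rintro ⟨i, u⟩ hi ⟨j, w⟩ hj (rfl : i = j)
  simp only [Finset.mem_coe, mem_invocations] at hi hj
  rw [hi] at hj
  rw [Option.some.inj hj]

/-- A choice of a view for every invocation of a `k`-immediate snapshot object, made as soon as
the object is obliged to respond. -/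
structure IsAssignment (k : ℕ) (inv : Fin n → Option U)
    (a : Fin n → Option (Finset (Fin n × U))) : Prop extends IsKImmediateSnapshot k inv a where
  complete : n ≤ (invocations inv).card + k → ∀ i, inv i ≠ none → a i ≠ none

/-- All invocations without a view get the current set of invocations, if it is large enough. -/
def assign (k : ℕ) (inv : Fin n → Option U) (a : Fin n → Option (Finset (Fin n × U))) :
    Fin n → Option (Finset (Fin n × U)) := fun i =>
  if a i = none ∧ inv i ≠ none ∧ n ≤ (invocations inv).card + k then some (invocations inv) else a i

theorem assign_eq_some {k : ℕ} {inv : Fin n → Option U} {a : Fin n → Option (Finset (Fin n × U))}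
    {i : Fin n} {X : Finset (Fin n × U)} (h : assign k inv a i = some X) :
    a i = some X ∨ (a i = none ∧ inv i ≠ none ∧ n ≤ (invocations inv).card + k ∧
      X = invocations inv) := by
  unfold assign at h
  split_ifs at h with hc
  · exact .inr ⟨hc.1, hc.2.1, hc.2.2, (Option.some.inj h).symm⟩
  · exact .inl h

theorem assign_of_some {k : ℕ} {inv : Fin n → Option U} {a : Fin n → Option (Finset (Fin n × U))}
    {i : Fin n} {X : Finset (Fin n × U)} (h : a i = some X) : assign k inv a i = some X := by
  simp [assign, h]

theorem assign_congr {k : ℕ} {inv : Fin n → Option U} {a b : Fin n → Option (Finset (Fin n × U))}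
    {i : Fin n} (h : a i = b i) : assign k inv a i = assign k inv b i := by
  simp only [assign, h]

theorem IsAssignment.subset_invocations {k : ℕ} {inv inv' : Fin n → Option U}
    {a : Fin n → Option (Finset (Fin n × U))} (h : IsAssignment k inv a)
    (hle : ∀ i u, inv i = some u → inv' i = some u) {i : Fin n} {X : Finset (Fin n × U)}
    (hX : a i = some X) : X ⊆ invocations inv' := by
  rintro ⟨j, u⟩ hj
  exact mem_invocations.2 (hle _ _ (h.validity i X hX j u hj))

/-- New views are the full set of invocations, hence contain all older ones. Immediacy is the
delicate point: a process occurring in an older view must not receive a larger one now. `complete`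
ensures that it already had its view. -/
theorem IsAssignment.assign {k : ℕ} {inv inv' : Fin n → Option U}
    {a : Fin n → Option (Finset (Fin n × U))} (h : IsAssignment k inv a)
    (hle : ∀ i u, inv i = some u → inv' i = some u) :
    IsAssignment k inv' (assign k inv' a) where
  self_inclusion i X hX := by
    rcases assign_eq_some hX with hX | ⟨-, hi, -, rfl⟩
    · obtain ⟨u, hu, hm⟩ := h.self_inclusion i X hX
      exact ⟨u, hle _ _ hu, hm⟩
    · obtain ⟨u, hu⟩ := Option.ne_none_iff_exists'.1 hi
      exact ⟨u, hu, mem_invocations.2 hu⟩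
  validity i X hX j u hj := by
    rcases assign_eq_some hX with hX | ⟨-, -, -, rfl⟩
    · exact hle _ _ (h.validity i X hX j u hj)
    · exact mem_invocations.1 hj
  containment i j X Y hX hY := by
    rcases assign_eq_some hX with hX | ⟨-, -, -, rfl⟩ <;>
      rcases assign_eq_some hY with hY | ⟨-, -, -, rfl⟩
    · exact h.containment i j X Y hX hY
    · exact .inl (h.subset_invocations hle hX)
    · exact .inr (h.subset_invocations hle hY)
    · exact .inl subset_rfl
  immediacy i j X Y u hX hY hij := by
    rcases assign_eq_some hY with hY | ⟨-, -, -, rfl⟩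
    -- The existence of the old view `Y` shows that at least `n - k` processes had invoked before,
    -- so `i`, being in `Y`, was already served.
    · have hc : n ≤ (invocations inv).card + k :=
        (h.output_size j Y hY).trans (Nat.add_le_add_right
          (Finset.card_le_card (h.subset_invocations (fun _ _ h => h) hY)) k)
      obtain ⟨X', hX'⟩ := Option.ne_none_iff_exists'.1
        (h.complete hc i (by simp [h.validity j Y hY i u hij]))
      rw [assign_of_some hX', Option.some.injEq] at hX
      exact hX ▸ h.immediacy i j X' Y u hX' hY hij
    · rcases assign_eq_some hX with hX | ⟨-, -, -, rfl⟩
      · exact h.subset_invocations hle hX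
      · exact subset_rfl
  output_size i X hX := by
    rcases assign_eq_some hX with hX | ⟨-, -, hc, rfl⟩
    · exact h.output_size i X hX
    · exact hc
  complete hc i hi := by
    unfold CrashModel.assign
    split_ifs with h'
    · simp
    · exact fun ha => h' ⟨ha, hi, hc⟩

theorem isAssignment_none (k : ℕ) :
    IsAssignment k (fun _ : Fin n => (none : Option U)) (fun _ => none) where
  self_inclusion := by simp
  validity := by simp
  containment := by simp
  immediacy := by simp
  output_size := by simp
  complete := by simp

/-- Assigning views after a first and a second invocation differs from assigning them after both
invocations for at most `max 1 (n - k)` processes. -/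
theorem IsAssignment.exists_assign_assign_eq {k t : ℕ} {inv inv₁ inv₂ : Fin n → Option U}
    {a : Fin n → Option (Finset (Fin n × U))} (h : IsAssignment k inv a) (p : Fin n)
    (hp : ∀ i ≠ p, inv₁ i = inv i) (ht : 1 ≤ t) (hkt : n ≤ t + k) :
    ∃ F : Finset (Fin n), F.card ≤ t ∧ ∀ i ∉ F,
      CrashModel.assign k inv₂ (CrashModel.assign k inv₁ a) i = CrashModel.assign k inv₂ a i := by
  classical
  by_cases h₁ : n ≤ (invocations inv₁).card + k
  · by_cases h₀ : n ≤ (invocations inv).card + k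
    -- The threshold was reached before `p` invoked: everybody else already has a view, and only `p`
    -- is served by the first assignment.
    · refine ⟨{p}, by simpa using ht, fun i hi => ?_⟩
      have hi : i ≠ p := by simpa using hi
      have : CrashModel.assign k inv₁ a i = a i := by
        unfold CrashModel.assign
        rw [if_neg]
        rintro ⟨ha, hi', -⟩
        rw [hp i hi] at hi'
        exact h.complete h₀ i hi' ha
      exact assign_congr this
    -- The invocation of `p` reaches the threshold: it serves at most `p` and the fewer than `n - k`
    -- earlier invokers, so at most `n - k ≤ t` processes.
    · refine ⟨insert p (Finset.univ.filter fun i => inv i ≠ none), ?_, fun i hi => ?_⟩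
      · have h₂ := card_invocations inv
        have h₃ : {i | inv i ≠ none} = (Finset.univ.filter fun i => inv i ≠ none : Finset _) := by
          ext; simp
        rw [h₃, Set.ncard_coe_finset] at h₂
        have := Finset.card_insert_le p (Finset.univ.filter fun i => inv i ≠ none)
        omega
      · simp only [Finset.mem_insert, Finset.mem_filter, Finset.mem_univ, true_and, not_or,
          not_not] at hi
        have : CrashModel.assign k inv₁ a i = a i := by
          unfold CrashModel.assign
          rw [if_neg]
          rintro ⟨ha, hi', -⟩
          rw [hp i hi.1] at hi'
          exact hi' hi.2
        exact assign_congr this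
  -- Still below the threshold, the first assignment does nothing.
  · refine ⟨∅, by simp, fun i _ => ?_⟩
    have : CrashModel.assign k inv₁ a = a := by
      funext i
      simp [CrashModel.assign, h₁]
    rw [this]

end Assignments

/-! ### Fair infinite sequences. -/

/-- A fair infinite sequence of transitions inside `B`, if from everywhere in `B` every label can
be reached without leaving `B`. -/
theorem exists_fair_sequence {α ι : Type*} (M : Option ι → α → α → Prop) (B : Set α)
    (g : ℕ → ι) (hg : ∀ p j, ∃ j', j ≤ j' ∧ g j' = p)
    (h : ∀ x ∈ B, ∀ p, ∃ y, Relation.ReflTransGen (fun a b => b ∈ B ∧ ∃ l, M l a b) x y ∧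
      ∃ z ∈ B, M (some p) y z) (x : α) (hx : x ∈ B) :
    ∃ (f : ℕ → α) (l : ℕ → Option ι), f 0 = x ∧ (∀ s, f s ∈ B) ∧
      (∀ s, M (l s) (f s) (f (s + 1))) ∧ ∀ p s, ∃ s', s ≤ s' ∧ l s' = some p := by
  -- `D p m x`: from `x`, after `m` moves inside `B`, a move labelled `p` into `B` is possible.
  let D : ι → ℕ → α → Prop := fun p m => Nat.rec (fun x => ∃ z ∈ B, M (some p) x z)
    (fun _ ih x => ∃ y ∈ B, (∃ l, M l x y) ∧ ih y) m
  have hD : ∀ x ∈ B, ∀ p, ∃ m, D p m x := by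
    intro x hx p
    obtain ⟨y, hxy, hy⟩ := h x hx p
    clear hx
    induction hxy using Relation.ReflTransGen.head_induction_on with
    | refl => exact ⟨0, hy⟩
    | head hab _ ih =>
      obtain ⟨m, hm⟩ := ih
      exact ⟨m + 1, _, hab.1, hab.2, hm⟩
  -- The state is enriched with the index of the label currently aimed at and a countdown of the
  -- moves left before it is performed.
  let P : α × ℕ × ℕ → Prop := fun q => q.1 ∈ B ∧ D (g q.2.1) q.2.2 q.1
  have key : ∀ q : {q // P q}, ∃ (q' : {q // P q}) (l : Option ι), M l q.1.1 q'.1.1 ∧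
      ((q.1.2.2 = 0 ∧ l = some (g q.1.2.1) ∧ q'.1.2.1 = q.1.2.1 + 1) ∨
        (q'.1.2.1 = q.1.2.1 ∧ q.1.2.2 = q'.1.2.2 + 1)) := by
    rintro ⟨⟨x, j, m⟩, hx, hm⟩
    cases m with
    | zero =>
      obtain ⟨z, hz, hM⟩ := hm
      obtain ⟨m', hm'⟩ := hD z hz (g (j + 1))
      exact ⟨⟨(z, j + 1, m'), hz, hm'⟩, _, hM, .inl ⟨rfl, rfl, rfl⟩⟩
    | succ m =>
      obtain ⟨y, hy, ⟨l, hM⟩, hm'⟩ := hm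
      exact ⟨⟨(y, j, m), hy, hm'⟩, l, hM, .inr ⟨rfl, rfl⟩⟩
  choose nxt lab hM hnxt using key
  obtain ⟨m, hm⟩ := hD x hx (g 0)
  let f : ℕ → {q // P q} := fun s => nxt^[s] ⟨(x, 0, m), hx, hm⟩
  have hf : ∀ s, f (s + 1) = nxt (f s) := fun s => Function.iterate_succ_apply' _ _ _
  have hzero : ∀ m s, (f s).1.2.2 = m →
      ∃ s', s ≤ s' ∧ (f s').1.2.1 = (f s).1.2.1 ∧ (f s').1.2.2 = 0 := by
    intro m
    induction m with
    | zero => exact fun s hs => ⟨s, le_rfl, rfl, hs⟩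
    | succ m ih =>
      intro s hs
      rcases hnxt (f s) with ⟨h0, -⟩ | ⟨h1, h2⟩
      · omega
      · rw [← hf] at h1 h2
        obtain ⟨s', h3, h4, h5⟩ := ih (s + 1) (by omega)
        exact ⟨s', by omega, h4.trans h1, h5⟩
  have hcount : ∀ d s, ∃ s', s ≤ s' ∧ (f s').1.2.1 = (f s).1.2.1 + d ∧ (f s').1.2.2 = 0 := by
    intro d
    induction d with
    | zero => exact fun s => hzero _ s rfl
    | succ d ih =>
      intro s
      obtain ⟨s₁, h1, h2, h3⟩ := ih s
      rcases hnxt (f s₁) with ⟨-, -, h4⟩ | ⟨-, h5⟩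
      · rw [← hf] at h4
        obtain ⟨s₂, h6, h7, h8⟩ := hzero _ (s₁ + 1) rfl
        exact ⟨s₂, by omega, by omega, h8⟩
      · omega
  refine ⟨fun s => (f s).1.1, fun s => lab (f s), rfl, fun s => (f s).2.1, fun s => ?_, ?_⟩
  · simp only [hf]; exact hM _
  · intro p s
    obtain ⟨j, hj, rfl⟩ := hg p (f s).1.2.1
    obtain ⟨d, rfl⟩ := Nat.exists_eq_add_of_le hj
    obtain ⟨s', h1, h2, h3⟩ := hcount d s
    refine ⟨s', h1, ?_⟩
    rcases hnxt (f s') with ⟨-, h4, -⟩ | ⟨-, h5⟩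
    · rw [← h2]; exact h4
    · omega

end CrashModel

/-! ### States with assigned views, and similarity. -/

namespace CrashModel

/-- A global state together with the views that the snapshot objects are going to return to the
invocations so far, and the values decided so far. -/
structure ScheduledState (n : ℕ) (V R W O U S : Type*) extends GlobalState n R W O U S where
  asg : O → Fin n → Option (Finset (Fin n × U))
  dec : Set V

namespace ScheduledState

variable {n : ℕ} {V R W O U S : Type*}

/-- The states differ only in what concerns the processes of `F`, or in the decisions. -/
structure Similar (F : Finset (Fin n)) (σ τ : ScheduledState n V R W O U S) : Prop where
  mem : σ.mem = τ.mem
  inv : σ.inv = τ.inv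
  loc : ∀ i ∉ F, σ.loc i = τ.loc i
  view : ∀ i ∉ F, ∀ o, σ.view o i = τ.view o i
  asg : ∀ i ∉ F, ∀ o, σ.asg o i = τ.asg o i

variable {F F' : Finset (Fin n)} {σ τ ρ : ScheduledState n V R W O U S}

theorem Similar.symm (h : Similar F σ τ) : Similar F τ σ :=
  ⟨h.mem.symm, h.inv.symm, fun i hi => (h.loc i hi).symm, fun i hi o => (h.view i hi o).symm,
    fun i hi o => (h.asg i hi o).symm⟩

theorem Similar.trans (h : Similar F σ τ) (h' : Similar F τ ρ) : Similar F σ ρ :=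
  ⟨h.mem.trans h'.mem, h.inv.trans h'.inv, fun i hi => (h.loc i hi).trans (h'.loc i hi),
    fun i hi o => (h.view i hi o).trans (h'.view i hi o),
    fun i hi o => (h.asg i hi o).trans (h'.asg i hi o)⟩

theorem Similar.mono (h : Similar F σ τ) (hF : F ⊆ F') : Similar F' σ τ :=
  ⟨h.mem, h.inv, fun i hi => h.loc i (fun h => hi (hF h)),
    fun i hi => h.view i (fun h => hi (hF h)), fun i hi => h.asg i (fun h => hi (hF h))⟩

/-- The views of at most `t` processes are assigned anew, in a consistent way. -/
structure Reassign (t k : ℕ) (σ τ : ScheduledState n V R W O U S) : Prop where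
  glob : τ.toGlobalState = σ.toGlobalState
  dec : τ.dec = σ.dec
  isAssignment : ∀ o, IsAssignment k (τ.inv o) (τ.asg o)
  view : ∀ o i X, τ.view o i = some X → τ.asg o i = some X
  asg : ∃ F : Finset (Fin n), F.card ≤ t ∧ ∀ i ∉ F, ∀ o, σ.asg o i = τ.asg o i

theorem Reassign.exists_similar {t k : ℕ} (h : Reassign t k σ τ) :
    ∃ F : Finset (Fin n), F.card ≤ t ∧ Similar F σ τ := by
  obtain ⟨F, hF, h'⟩ := h.asg
  have hg := h.glob
  exact ⟨F, hF, by rw [hg], by rw [hg], fun i _ => by rw [hg], fun i _ o => by rw [hg], h'⟩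

end ScheduledState

/-! ### Steps of the adversary and their invariants. -/

namespace Algorithm

open ScheduledState

variable {n : ℕ} {V R W O U S : Type*} (A : Algorithm n V R W O U S) (t k : ℕ)

/-- Process `i` executes its next operation or obtains the view assigned to its pending
invocation. -/
noncomputable def step (i : Fin n) (σ : ScheduledState n V R W O U S) :
    ScheduledState n V R W O U S := by
  classical exact
  match A.next i (σ.loc i) with
  | .read r j cont => { σ with loc := Function.update σ.loc i (cont (σ.mem r j)) }
  | .write r w cont =>
    { σ with
      loc := Function.update σ.loc i cont
      mem := Function.update σ.mem r (Function.update (σ.mem r) i w) }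
  | .decide v cont => { σ with loc := Function.update σ.loc i cont, dec := insert v σ.dec }
  | .snapshot o u cont =>
    if σ.inv o i = none then
      { σ with
        inv := Function.update σ.inv o (Function.update (σ.inv o) i (some u))
        asg := Function.update σ.asg o
          (assign k (Function.update (σ.inv o) i (some u)) (σ.asg o)) }
    else match σ.view o i, σ.asg o i with
      | none, some X =>
        { σ with
          loc := Function.update σ.loc i (cont X)
          view := Function.update σ.view o (Function.update (σ.view o) i (some X)) }
      | _, _ => σ

variable {A k} {i : Fin n} {σ τ : ScheduledState n V R W O U S}

theorem step_read {r j cont} (h : A.next i (σ.loc i) = .read r j cont) :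
    A.step k i σ = { σ with loc := Function.update σ.loc i (cont (σ.mem r j)) } := by
  simp [step, h]

open Classical in
theorem step_write {r w cont} (h : A.next i (σ.loc i) = .write r w cont) :
    A.step k i σ = { σ with
      loc := Function.update σ.loc i cont
      mem := Function.update σ.mem r (Function.update (σ.mem r) i w) } := by
  simp [step, h]

theorem step_decide {v cont} (h : A.next i (σ.loc i) = .decide v cont) :
    A.step k i σ = { σ with loc := Function.update σ.loc i cont, dec := insert v σ.dec } := by
  simp [step, h]

open Classical in
theorem step_invoke {o u cont} (h : A.next i (σ.loc i) = .snapshot o u cont)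
    (hi : σ.inv o i = none) :
    A.step k i σ = { σ with
        inv := Function.update σ.inv o (Function.update (σ.inv o) i (some u))
        asg := Function.update σ.asg o
          (assign k (Function.update (σ.inv o) i (some u)) (σ.asg o)) } := by
  simp [step, h, hi]

open Classical in
theorem step_respond {o u cont X} (h : A.next i (σ.loc i) = .snapshot o u cont)
    (hi : σ.inv o i ≠ none) (hv : σ.view o i = none) (ha : σ.asg o i = some X) :
    A.step k i σ = { σ with
          loc := Function.update σ.loc i (cont X)
          view := Function.update σ.view o (Function.update (σ.view o) i (some X)) } := by
  simp [step, h, hi, hv, ha]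

theorem step_blocked {o u cont} (h : A.next i (σ.loc i) = .snapshot o u cont)
    (hi : σ.inv o i ≠ none) (hv : σ.view o i ≠ none ∨ σ.asg o i = none) :
    A.step k i σ = σ := by
  rcases hv with hv | ha
  · obtain ⟨X, hX⟩ := Option.ne_none_iff_exists'.1 hv
    simp [step, h, hi, hX]
  · simp [step, h, hi, ha]

/-- The possible effects of a step. -/
theorem step_cases (A : Algorithm n V R W O U S) (i : Fin n)
    (σ : ScheduledState n V R W O U S) :
    (∃ r j cont, A.next i (σ.loc i) = .read r j cont) ∨
    (∃ r w cont, A.next i (σ.loc i) = .write r w cont) ∨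
    (∃ v cont, A.next i (σ.loc i) = .decide v cont) ∨
    (∃ o u cont, A.next i (σ.loc i) = .snapshot o u cont ∧ σ.inv o i = none) ∨
    (∃ o u cont X, A.next i (σ.loc i) = .snapshot o u cont ∧ σ.inv o i ≠ none ∧
      σ.view o i = none ∧ σ.asg o i = some X) ∨
    (∃ o u cont, A.next i (σ.loc i) = .snapshot o u cont ∧ σ.inv o i ≠ none ∧
      (σ.view o i ≠ none ∨ σ.asg o i = none)) := by
  rcases h : A.next i (σ.loc i) with ⟨r, j, cont⟩ | ⟨r, w, cont⟩ | ⟨o, u, cont⟩ | ⟨v, cont⟩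
  · exact .inl ⟨_, _, _, rfl⟩
  · exact .inr (.inl ⟨_, _, _, rfl⟩)
  · by_cases hi : σ.inv o i = none
    · exact .inr (.inr (.inr (.inl ⟨_, _, _, rfl, hi⟩)))
    · by_cases hv : σ.view o i = none
      · rcases ha : σ.asg o i with _ | X
        · exact .inr (.inr (.inr (.inr (.inr ⟨_, _, _, rfl, hi, .inr ha⟩))))
        · exact .inr (.inr (.inr (.inr (.inl ⟨_, _, _, _, rfl, hi, hv, ha⟩))))
      · exact .inr (.inr (.inr (.inr (.inr ⟨_, _, _, rfl, hi, .inl hv⟩))))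
  · exact .inr (.inr (.inl ⟨_, _, rfl⟩))

theorem step_loc_of_ne {j : Fin n} (hj : j ≠ i) : (A.step k i σ).loc j = σ.loc j := by
  rcases A.step_cases i σ with ⟨r, j', cont, h⟩ | ⟨r, w, cont, h⟩ | ⟨v, cont, h⟩ |
    ⟨o, u, cont, h, hi⟩ | ⟨o, u, cont, X, h, hi, hv, ha⟩ | ⟨o, u, cont, h, hi, hv⟩
  · simp [step_read h, hj]
  · simp [step_write h, hj]
  · simp [step_decide h, hj]
  · simp [step_invoke h hi]
  · simp [step_respond h hi hv ha, hj]
  · simp [step_blocked h hi hv]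

theorem step_inv_of_ne {j : Fin n} (hj : j ≠ i) (o : O) :
    (A.step k i σ).inv o j = σ.inv o j := by
  classical
  rcases A.step_cases i σ with ⟨r, j', cont, h⟩ | ⟨r, w, cont, h⟩ | ⟨v, cont, h⟩ |
    ⟨o', u, cont, h, hi⟩ | ⟨o', u, cont, X, h, hi, hv, ha⟩ | ⟨o', u, cont, h, hi, hv⟩
  · simp [step_read h]
  · simp [step_write h]
  · simp [step_decide h]
  · rw [step_invoke h hi]
    by_cases ho : o = o'
    · subst ho; simp [hj]
    · simp [ho]
  · simp [step_respond h hi hv ha]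
  · simp [step_blocked h hi hv]

theorem step_dec : (A.step k i σ).dec =
    {v | ∃ cont, A.next i (σ.loc i) = .decide v cont} ∪ σ.dec := by
  rcases A.step_cases i σ with ⟨r, j', cont, h⟩ | ⟨r, w, cont, h⟩ | ⟨v, cont, h⟩ |
    ⟨o', u, cont, h, hi⟩ | ⟨o', u, cont, X, h, hi, hv, ha⟩ | ⟨o', u, cont, h, hi, hv⟩
  · simp [step_read h, h]
  · simp [step_write h, h]
  · rw [step_decide h]; ext w; simp [h, eq_comm]
  · simp [step_invoke h hi, h]
  · simp [step_respond h hi hv ha, h]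
  · simp [step_blocked h hi hv, h]

/-- The next step of process `i` has no effect on other processes. -/
def IsPassive (A : Algorithm n V R W O U S) (i : Fin n) (σ : ScheduledState n V R W O U S) : Prop :=
  (∃ r j cont, A.next i (σ.loc i) = .read r j cont) ∨
  (∃ v cont, A.next i (σ.loc i) = .decide v cont) ∨
  (∃ o u cont, A.next i (σ.loc i) = .snapshot o u cont ∧ σ.inv o i ≠ none)

theorem IsPassive.similar (h : A.IsPassive i σ) : Similar {i} (A.step k i σ) σ := by
  classical
  rcases h with ⟨r, j, cont, h⟩ | ⟨v, cont, h⟩ | ⟨o, u, cont, h, hi⟩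
  · rw [step_read h]
    refine ⟨rfl, rfl, fun j hj => ?_, fun _ _ _ => rfl, fun _ _ _ => rfl⟩
    simp [Finset.notMem_singleton.1 hj]
  · rw [step_decide h]
    refine ⟨rfl, rfl, fun j hj => ?_, fun _ _ _ => rfl, fun _ _ _ => rfl⟩
    simp [Finset.notMem_singleton.1 hj]
  · by_cases hv : σ.view o i ≠ none ∨ σ.asg o i = none
    · rw [step_blocked h hi hv]
      exact ⟨rfl, rfl, fun _ _ => rfl, fun _ _ _ => rfl, fun _ _ _ => rfl⟩
    · obtain ⟨hv, ha⟩ := not_or.1 hv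
      obtain ⟨X, hX⟩ := Option.ne_none_iff_exists'.1 ha
      rw [step_respond h hi (not_not.1 hv) hX]
      refine ⟨rfl, rfl, fun j hj => ?_, fun j hj o' => ?_, fun _ _ _ => rfl⟩
      · simp [Finset.notMem_singleton.1 hj]
      · by_cases ho : o' = o
        · subst ho; simp [Finset.notMem_singleton.1 hj]
        · simp [ho]

theorem IsPassive.step {j : Fin n} (h : A.IsPassive i σ) (hij : i ≠ j) :
    A.IsPassive i (A.step k j σ) := by
  simpa only [IsPassive, step_loc_of_ne hij, step_inv_of_ne hij] using h

theorem not_isPassive (h : ¬ A.IsPassive i σ) :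
    (∃ r w cont, A.next i (σ.loc i) = .write r w cont) ∨
    (∃ o u cont, A.next i (σ.loc i) = .snapshot o u cont ∧ σ.inv o i = none) := by
  rcases A.step_cases i σ with ⟨r, j', cont, h'⟩ | ⟨r, w, cont, h'⟩ | ⟨v, cont, h'⟩ |
    ⟨o', u, cont, h', hi⟩ | ⟨o', u, cont, X, h', hi, hv, ha⟩ | ⟨o', u, cont, h', hi, hv⟩
  · exact absurd (.inl ⟨_, _, _, h'⟩) h
  · exact .inl ⟨_, _, _, h'⟩
  · exact absurd (.inr (.inl ⟨_, _, h'⟩)) h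
  · exact .inr ⟨_, _, _, h', hi⟩
  · exact absurd (.inr (.inr ⟨_, _, _, h', hi⟩)) h
  · exact absurd (.inr (.inr ⟨_, _, _, h', hi⟩)) h

/-- The stepping process may belong to `F`. A write or an invocation then has the same effect on
both sides, as it depends only on the local state and the shared memory; any other step changes
nothing outside `F`. Views remain similar after an invocation because `assign` acts on each process
separately. -/
theorem similar_step {F : Finset (Fin n)} (h : Similar F σ τ) (hi : σ.loc i = τ.loc i) :
    Similar F (A.step k i σ) (A.step k i τ) := by
  classical
  by_cases hp : A.IsPassive i σ ∧ i ∈ F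
  · have hp' : A.IsPassive i τ := by simpa only [IsPassive, hi, h.inv] using hp.1
    have hF : {i} ⊆ F := by simpa using hp.2
    exact ((hp.1.similar.mono hF).trans h).trans (hp'.similar.mono hF).symm
  have hloc : ∀ s j, j ∉ F → Function.update σ.loc i s j = Function.update τ.loc i s j := by
    intro s j hj
    by_cases hji : j = i
    · subst hji; simp
    · simp [hji, h.loc j hj]
  rcases A.step_cases i σ with ⟨r, j', cont, h'⟩ | ⟨r, w, cont, h'⟩ | ⟨v, cont, h'⟩ |
    ⟨o', u, cont, h', hi'⟩ | ⟨o', u, cont, X, h', hi', hv, ha⟩ | ⟨o', u, cont, h', hi', hv⟩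
  · rw [step_read h', step_read (hi ▸ h')]
    refine ⟨h.mem, h.inv, ?_, h.view, h.asg⟩
    simp only [h.mem]
    exact hloc _
  · rw [step_write h', step_write (hi ▸ h')]
    refine ⟨?_, h.inv, hloc _, h.view, h.asg⟩
    simp only [h.mem]
  · rw [step_decide h', step_decide (hi ▸ h')]
    exact ⟨h.mem, h.inv, hloc _, h.view, h.asg⟩
  · rw [step_invoke h' hi', step_invoke (hi ▸ h') (by rw [← h.inv]; exact hi')]
    refine ⟨h.mem, ?_, h.loc, h.view, fun j hj o => ?_⟩
    · simp only [h.inv]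
    · by_cases ho : o = o'
      · subst ho; simp [assign, h.inv, h.asg j hj]
      · simp [ho, h.asg j hj]
  · have hiF : i ∉ F := fun hF => hp ⟨.inr (.inr ⟨_, _, _, h', hi'⟩), hF⟩
    rw [step_respond h' hi' hv ha, step_respond (hi ▸ h') (by rw [← h.inv]; exact hi')
      (by rw [← h.view i hiF]; exact hv) (by rw [← h.asg i hiF]; exact ha)]
    refine ⟨h.mem, h.inv, hloc _, fun j hj o => ?_, h.asg⟩
    by_cases ho : o = o'
    · subst ho
      by_cases hji : j = i
      · subst hji; simp
      · simp [hji, h.view j hj]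
    · simp [ho, h.view j hj]
  · have hiF : i ∉ F := fun hF => hp ⟨.inr (.inr ⟨_, _, _, h', hi'⟩), hF⟩
    rw [step_blocked h' hi' hv, step_blocked (hi ▸ h') (by rw [← h.inv]; exact hi')
      (by rw [← h.view i hiF, ← h.asg i hiF]; exact hv)]
    exact h

/-- Invariants of the states that occur in executions. -/
structure IsConsistent (A : Algorithm n V R W O U S) (k : ℕ)
    (σ : ScheduledState n V R W O U S) : Prop where
  isAssignment : ∀ o, IsAssignment k (σ.inv o) (σ.asg o)
  view : ∀ o i X, σ.view o i = some X → σ.asg o i = some X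
  inside : ∀ i o, σ.Inside i o → ∃ u cont, A.next i (σ.loc i) = .snapshot o u cont

/-- Moves of the adversary: a step of a process, or a change of the assigned views. -/
inductive Move (A : Algorithm n V R W O U S) (t k : ℕ) : Option (Fin n) →
    ScheduledState n V R W O U S → ScheduledState n V R W O U S → Prop where
  | step (i : Fin n) (σ : ScheduledState n V R W O U S) : A.Move t k (some i) σ (A.step k i σ)
  | reassign {σ τ : ScheduledState n V R W O U S} (h : Reassign t k σ τ) : A.Move t k none σ τ

theorem IsConsistent.not_waiting (h : A.IsConsistent k σ)
    (hi : ∀ o u cont, A.next i (σ.loc i) = .snapshot o u cont → σ.inv o i = none) :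
    ¬ σ.Waiting i := by
  rintro ⟨o, ho⟩
  obtain ⟨u, cont, h'⟩ := h.inside i o ho
  exact ho.1 (hi o u cont h')

theorem IsConsistent.step (h : A.IsConsistent k σ) : A.IsConsistent k (A.step k i σ) := by
  classical
  have hins : ∀ s, (∀ o u cont, A.next i (σ.loc i) ≠ .snapshot o u cont) → ∀ j o, σ.Inside j o →
      ∃ u cont, A.next j (Function.update σ.loc i s j) = .snapshot o u cont := by
    intro s hs j o hj
    obtain ⟨u, cont, h'⟩ := h.inside j o hj
    by_cases hji : j = i
    · exact absurd (hji ▸ h') (hs o u cont)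
    · exact ⟨u, cont, by rw [Function.update_of_ne hji]; exact h'⟩
  rcases A.step_cases i σ with ⟨r, j', cont, h'⟩ | ⟨r, w, cont, h'⟩ | ⟨v, cont, h'⟩ |
    ⟨o', u, cont, h', hi'⟩ | ⟨o', u, cont, X, h', hi', hv, ha⟩ | ⟨o', u, cont, h', hi', hv⟩
  · rw [step_read h']
    exact ⟨h.isAssignment, h.view, hins _ (by simp [h'])⟩
  · rw [step_write h']
    exact ⟨h.isAssignment, h.view, hins _ (by simp [h'])⟩
  · rw [step_decide h']
    exact ⟨h.isAssignment, h.view, hins _ (by simp [h'])⟩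
  · rw [step_invoke h' hi']
    refine ⟨fun o => ?_, fun o j X hX => ?_, fun j o ⟨hj, hj'⟩ => ?_⟩
    · by_cases ho : o = o'
      · subst ho
        simp only [Function.update_self]
        refine (h.isAssignment o).assign fun j w hj => ?_
        rw [Function.update_of_ne]
        · exact hj
        · rintro rfl; simp [hi'] at hj
      · simpa [ho] using h.isAssignment o
    · by_cases ho : o = o'
      · subst ho
        simpa using assign_of_some (h.view _ _ _ hX)
      · simpa [ho] using h.view _ _ _ hX
    · by_cases hji : j = i ∧ o = o'
      · obtain ⟨rfl, rfl⟩ := hji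
        exact ⟨_, _, h'⟩
      · refine h.inside j o ⟨?_, hj'⟩
        by_cases ho : o = o'
        · subst ho
          have hji : j ≠ i := fun h => hji ⟨h, rfl⟩
          simpa [hji] using hj
        · simpa [ho] using hj
  · rw [step_respond h' hi' hv ha]
    refine ⟨h.isAssignment, fun o j Y hY => ?_, fun j o ⟨hj, hj'⟩ => ?_⟩
    · by_cases hji : j = i ∧ o = o'
      · obtain ⟨rfl, rfl⟩ := hji
        simp only [Function.update_self] at hY
        exact hY ▸ ha
      · refine h.view o j Y ?_
        by_cases ho : o = o'
        · subst ho
          have hji : j ≠ i := fun h => hji ⟨h, rfl⟩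
          simpa [hji] using hY
        · simpa [ho] using hY
    · have hjo : ¬ (j = i ∧ o = o') := by
        rintro ⟨rfl, rfl⟩
        simp at hj'
      have hj'' : σ.view o j = none := by
        by_cases ho : o = o'
        · subst ho
          have hji : j ≠ i := fun h => hjo ⟨h, rfl⟩
          simpa [hji] using hj'
        · simpa [ho] using hj'
      obtain ⟨u', cont', h''⟩ := h.inside j o ⟨hj, hj''⟩
      -- The next operation of `i` names a single object, so `i` cannot be inside another one and
      -- lose its pending operation by moving on.
      have hji : j ≠ i := by
        rintro rfl
        rw [h'] at h''
        injection h'' with h1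
        exact hjo ⟨rfl, h1.symm⟩
      exact ⟨u', cont', by simpa [hji] using h''⟩
  · rw [step_blocked h' hi' hv]
    exact h

variable {t}

theorem IsConsistent.reassign (h : A.IsConsistent k σ) (h' : Reassign t k σ τ) :
    A.IsConsistent k τ :=
  ⟨h'.isAssignment, h'.view, by rw [h'.glob]; exact h.inside⟩

theorem IsConsistent.move {l : Option (Fin n)} (h : A.IsConsistent k σ) (h' : A.Move t k l σ τ) :
    A.IsConsistent k τ := by
  cases h' with
  | step i => exact h.step
  | reassign h' => exact h.reassign h'

theorem IsConsistent.reassign_refl (h : A.IsConsistent k σ) : Reassign t k σ σ :=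
  ⟨rfl, rfl, h.isAssignment, h.view, ∅, by simp, fun _ _ _ => rfl⟩

theorem IsConsistent.safe (h : A.IsConsistent k σ) (o : O) :
    IsKImmediateSnapshot k (σ.inv o) (σ.view o) where
  self_inclusion i X hX := (h.isAssignment o).self_inclusion i X (h.view o i X hX)
  validity i X hX := (h.isAssignment o).validity i X (h.view o i X hX)
  containment i j X Y hX hY :=
    (h.isAssignment o).containment i j X Y (h.view o i X hX) (h.view o j Y hY)
  immediacy i j X Y u hX hY :=
    (h.isAssignment o).immediacy i j X Y u (h.view o i X hX) (h.view o j Y hY)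
  output_size i X hX := (h.isAssignment o).output_size i X (h.view o i X hX)

/-- Links steps of the adversary to transitions of the model. A blocked step becomes an idle event,
which is why the third clause allows for a pending snapshot operation. -/
theorem IsConsistent.exists_trans (h : A.IsConsistent k σ) (i : Fin n) :
    ∃ e, A.Trans σ.toGlobalState e (A.step k i σ).toGlobalState ∧ (∀ j, e.IsBy j → j = i) ∧
      (e.IsBy i ∨ ∃ o u cont, A.next i (σ.loc i) = .snapshot o u cont ∧ σ.inv o i ≠ none) ∧
      ∀ v cont, A.next i (σ.loc i) = .decide v cont → e = .step i := by
  rcases A.step_cases i σ with ⟨r, j', cont, h'⟩ | ⟨r, w, cont, h'⟩ | ⟨v, cont, h'⟩ |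
    ⟨o', u, cont, h', hi'⟩ | ⟨o', u, cont, X, h', hi', hv, ha⟩ | ⟨o', u, cont, h', hi', hv⟩
  · rw [step_read h']
    exact ⟨_, .read _ i r j' cont (h.not_waiting (by simp [h'])) h', fun j hj => hj.symm,
      .inl rfl, fun _ _ _ => rfl⟩
  · rw [step_write h']
    exact ⟨_, .write _ i r w cont (h.not_waiting (by simp [h'])) h', fun j hj => hj.symm,
      .inl rfl, fun _ _ _ => rfl⟩
  · rw [step_decide h']
    exact ⟨_, .decide _ i v cont (h.not_waiting (by simp [h'])) h', fun j hj => hj.symm,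
      .inl rfl, fun _ _ _ => rfl⟩
  · rw [step_invoke h' hi']
    refine ⟨_, .invoke _ i o' u cont (h.not_waiting ?_) h' hi', fun j hj => hj.symm,
      .inl rfl, fun _ _ _ => rfl⟩
    rintro o u' cont' h''
    rw [h'] at h''
    injection h'' with h1
    rw [← h1]; exact hi'
  · rw [step_respond h' hi' hv ha]
    exact ⟨_, .respond _ i o' u cont X ⟨hi', hv⟩ h', fun j hj => hj.symm, .inl rfl,
      by simp [h']⟩
  · rw [step_blocked h' hi' hv]
    exact ⟨_, .idle _, fun j hj => hj.elim, .inr ⟨_, _, _, h', hi'⟩, by simp [h']⟩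

theorem IsConsistent.step_view_ne_none (h : A.IsConsistent k σ) {o : O}
    (hc : n ≤ {i | σ.inv o i ≠ none}.ncard + k) (hi : σ.inv o i ≠ none) :
    (A.step k i σ).view o i ≠ none ∨ σ.view o i ≠ none := by
  by_cases hv : σ.view o i = none
  · left
    obtain ⟨u, cont, h'⟩ := h.inside i o ⟨hi, hv⟩
    rw [← card_invocations] at hc
    obtain ⟨X, hX⟩ := Option.ne_none_iff_exists'.1 ((h.isAssignment o).complete hc i hi)
    rw [step_respond h' hi hv hX]
    simp
  · exact .inr hv

end Algorithm
end CrashModel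

/-! ### From sequences of moves to runs. -/

namespace CrashModel
namespace Algorithm

open ScheduledState

variable {n : ℕ} {V R W O U S : Type*}

/-- The initial state of an execution with assigned views. -/
def scheduledInitial (A : Algorithm n V R W O U S) (input : Fin n → V) :
    ScheduledState n V R W O U S where
  toGlobalState := A.initial input
  asg _ _ := none
  dec := ∅

/-- Reachability by moves of the adversary. -/
def Reaches (A : Algorithm n V R W O U S) (t k : ℕ) :
    ScheduledState n V R W O U S → ScheduledState n V R W O U S → Prop :=
  Relation.ReflTransGen fun σ τ => ∃ l, A.Move t k l σ τ

variable {A : Algorithm n V R W O U S} {t k : ℕ} {input : Fin n → V}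
  {σ τ : ScheduledState n V R W O U S}

theorem isConsistent_scheduledInitial : A.IsConsistent k (A.scheduledInitial input) where
  isAssignment _ := isAssignment_none k
  view o i X h := by simp [scheduledInitial, initial] at h
  inside i o h := absurd rfl h.1

theorem Reaches.isConsistent (h : A.Reaches t k σ τ) (hσ : A.IsConsistent k σ) :
    A.IsConsistent k τ := by
  induction h with
  | refl => exact hσ
  | tail _ h' ih => exact ih.move h'.choose_spec

theorem Reaches.step (h : A.Reaches t k σ τ) (i : Fin n) : A.Reaches t k σ (A.step k i τ) :=
  h.tail ⟨_, .step i τ⟩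

theorem Move.dec_subset {l : Option (Fin n)} (h : A.Move t k l σ τ) : σ.dec ⊆ τ.dec := by
  cases h with
  | step i => rw [step_dec]; exact Set.subset_union_right
  | reassign h' => exact h'.dec.ge

theorem Reaches.dec_subset (h : A.Reaches t k σ τ) : σ.dec ⊆ τ.dec := by
  induction h with
  | refl => exact subset_rfl
  | tail _ h' ih => exact ih.trans h'.choose_spec.dec_subset

/-- A fair infinite sequence of moves is a run. -/
theorem exists_isRun (hone : A.OneShot k) {σ : ℕ → ScheduledState n V R W O U S}
    {l : ℕ → Option (Fin n)} (h0 : σ 0 = A.scheduledInitial input)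
    (hm : ∀ s, A.Move t k (l s) (σ s) (σ (s + 1))) {F : Finset (Fin n)} (hF : F.card ≤ t)
    (hcrash : ∀ i ∈ F, ∃ s, ∀ s', s ≤ s' → l s' ≠ some i)
    (hfair : ∀ i ∉ F, ∀ s, ∃ s', s ≤ s' ∧ l s' = some i) :
    ∃ e, A.IsRun t k input (fun s => (σ s).toGlobalState) e F ∧
      (∀ s, ∀ v ∈ (σ s).dec, ∃ i, A.Decides (fun s => (σ s).toGlobalState) e i v) ∧
      ∀ i v, A.Decides (fun s => (σ s).toGlobalState) e i v → ∃ s, v ∈ (σ s).dec := by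
  have hcons : ∀ s, A.IsConsistent k (σ s) := by
    intro s
    induction s with
    | zero => rw [h0]; exact isConsistent_scheduledInitial
    | succ s ih => exact ih.move (hm s)
  have hev : ∀ s, ∃ e, A.Trans (σ s).toGlobalState e (σ (s + 1)).toGlobalState ∧
      (∀ j, e.IsBy j → l s = some j) ∧
      (∀ i, l s = some i →
        (e.IsBy i ∨
          ∃ o u cont, A.next i ((σ s).loc i) = .snapshot o u cont ∧ (σ s).inv o i ≠ none) ∧
        ∀ v cont, A.next i ((σ s).loc i) = .decide v cont → e = .step i) := by
    intro s
    have hs := hm s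
    generalize σ (s + 1) = τ at hs
    generalize l s = l' at hs
    cases hs with
    | step i =>
      obtain ⟨e, h1, h2, h3, h4⟩ := (hcons s).exists_trans i
      refine ⟨e, h1, fun j hj => by rw [h2 j hj], fun j hj => ?_⟩
      cases hj
      exact ⟨h3, h4⟩
    | reassign h =>
      refine ⟨.idle, ?_, fun j hj => hj.elim, fun j hj => by cases hj⟩
      rw [h.glob]
      exact .idle _
  choose e he hby hl using hev
  have hexec : A.IsExecution k input (fun s => (σ s).toGlobalState) e :=
    ⟨by simp [h0, scheduledInitial], he, fun s o => (hcons s).safe o⟩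
  have hdecs : ∀ s i, l s = some i → (σ (s + 1)).dec =
      {v | ∃ cont, A.next i ((σ s).loc i) = .decide v cont} ∪ (σ s).dec ∧
      σ (s + 1) = A.step k i (σ s) := by
    intro s i hs
    have hs' := hm s
    rw [hs] at hs'
    generalize σ (s + 1) = τ at hs'
    cases hs'
    exact ⟨step_dec, rfl⟩
  have hinv : ∀ o i s s', s ≤ s' → (σ s).inv o i ≠ none → (σ s').inv o i ≠ none := by
    intro o i s s' hs
    induction s', hs using Nat.le_induction with
    | base => exact id
    | succ s' _ ih =>
      intro hi
      have hs' := hm s'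
      generalize σ (s' + 1) = τ at hs'
      generalize l s' = l' at hs'
      cases hs' with
      | reassign h => rw [h.glob]; exact ih hi
      | step j =>
        have hi := ih hi
        by_cases hij : i = j
        · subst hij
          rcases A.step_cases i (σ s') with ⟨r, j', cont, h⟩ | ⟨r, w, cont, h⟩ | ⟨v, cont, h⟩ |
            ⟨o', u, cont, h, hi'⟩ | ⟨o', u, cont, X, h, hi', hv, ha⟩ | ⟨o', u, cont, h, hi', hv⟩
          · simpa [step_read h]
          · simpa [step_write h]
          · simpa [step_decide h]
          · rw [step_invoke h hi']
            by_cases ho : o = o'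
            · subst ho; simp
            · simpa [ho] using hi
          · simpa [step_respond h hi' hv ha]
          · simpa [step_blocked h hi' hv]
        · rwa [step_inv_of_ne hij]
  refine ⟨e, ⟨hexec, hF, ?_, ?_, ?_⟩, ?_, ?_⟩
  · intro i hi
    obtain ⟨s, hs⟩ := hcrash i hi
    exact ⟨s, fun s' hs' h => hs s' hs' (hby s' i h)⟩
  · intro i hi s
    obtain ⟨s', hs', hls⟩ := hfair i hi s
    -- When the turn of `i` yields an idle event, `i` must be waiting: otherwise it would be
    -- invoking an object twice.
    refine ⟨s', hs', (hl s' i hls).1.imp_right ?_⟩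
    rintro ⟨o, u, cont, h1, h2⟩
    by_contra hw
    exact h2 (hone input _ e hexec s' i o u cont hw h1)
  · rintro o hcard i hi ⟨s, hs⟩
    -- There are finitely many processes, so at some time all invocations that ever occur have
    -- occurred; at its next turn `i` then has a view assigned and receives it, unless it did
    -- earlier.
    have hfull : ∃ s, {i | ∃ s, (σ s).inv o i ≠ none} ⊆ {i | (σ s).inv o i ≠ none} := by
      have : ∀ i, ∃ s, (∃ s, (σ s).inv o i ≠ none) → (σ s).inv o i ≠ none := by
        intro i
        by_cases h : ∃ s, (σ s).inv o i ≠ none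
        · exact ⟨h.choose, fun _ => h.choose_spec⟩
        · exact ⟨0, fun h' => absurd h' h⟩
      choose f hf using this
      refine ⟨Finset.univ.sup f, fun i hi => ?_⟩
      exact hinv o i _ _ (Finset.le_sup (Finset.mem_univ i)) (hf i hi)
    obtain ⟨s₁, hs₁⟩ := hfull
    obtain ⟨s', hs', hls⟩ := hfair i hi (max s s₁)
    have h1 : n ≤ {i | (σ s').inv o i ≠ none}.ncard + k := by
      refine hcard.trans (Nat.add_le_add_right (Set.ncard_le_ncard ?_) k)
      exact fun j hj => hinv o j s₁ s' (by omega) (hs₁ hj)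
    rcases (hcons s').step_view_ne_none h1 (hinv o i s s' (by omega) hs) with h | h
    · exact ⟨s' + 1, by rw [(hdecs s' i hls).2]; exact h⟩
    · exact ⟨s', h⟩
  · intro s
    induction s with
    | zero => simp [h0, scheduledInitial]
    | succ s ih =>
      intro v hv
      rcases hls : l s with _ | i
      · have hs' := hm s
        rw [hls] at hs'
        cases hs' with
        | reassign h =>
          rw [h.dec] at hv
          exact ih v hv
      · rw [(hdecs s i hls).1] at hv
        rcases hv with ⟨cont, hv⟩ | hv
        · exact ⟨i, s, cont, (hl s i hls).2 v cont hv, hv⟩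
        · exact ih v hv
  · rintro i v ⟨s, cont, hs, hv⟩
    have hls : l s = some i := hby s i (by rw [hs]; rfl)
    exact ⟨s + 1, by rw [(hdecs s i hls).1]; exact .inl ⟨cont, hv⟩⟩

theorem Reaches.exists_sequence (h : A.Reaches t k σ τ) {f : ℕ → ScheduledState n V R W O U S}
    {l : ℕ → Option (Fin n)} (h0 : f 0 = τ) (hm : ∀ s, A.Move t k (l s) (f s) (f (s + 1))) :
    ∃ (f' : ℕ → ScheduledState n V R W O U S) (l' : ℕ → Option (Fin n)) (N : ℕ), f' 0 = σ ∧
      (∀ s, A.Move t k (l' s) (f' s) (f' (s + 1))) ∧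
      ∀ s, f' (s + N) = f s ∧ l' (s + N) = l s := by
  induction h using Relation.ReflTransGen.head_induction_on with
  | refl => exact ⟨f, l, 0, h0, hm, fun s => ⟨rfl, rfl⟩⟩
  | @head a b hab _ ih =>
    obtain ⟨f', l', N, h0', hm', heq⟩ := ih
    obtain ⟨l₀, hl₀⟩ := hab
    refine ⟨fun s => Nat.casesOn s a f', fun s => Nat.casesOn s l₀ l', N + 1, rfl, ?_, heq⟩
    rintro (_ | s)
    · simpa [h0'] using hl₀
    · exact hm' s

/-- The process whose turn it is in a round-robin schedule. -/
def roundRobin [NeZero n] (s : ℕ) : Fin n := Fin.ofNat n s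

theorem exists_roundRobin_eq [NeZero n] (i : Fin n) (s : ℕ) :
    ∃ s', s ≤ s' ∧ roundRobin s' = i := by
  refine ⟨i + n * s, ?_, ?_⟩
  · have := Nat.le_mul_of_pos_left s (NeZero.pos n)
    omega
  · ext
    simp [roundRobin, Fin.ofNat, Nat.mod_eq_of_lt i.2]

/-- The round-robin schedule of the processes outside `F`. -/
def label [NeZero n] (F : Finset (Fin n)) (s : ℕ) : Option (Fin n) :=
  if roundRobin s ∈ F then none else some (roundRobin s)

/-- The states that follow `σ` if the processes of `F` crash and the other ones take steps in
turn. -/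
noncomputable def schedule [NeZero n] (A : Algorithm n V R W O U S) (k : ℕ) (F : Finset (Fin n))
    (σ : ScheduledState n V R W O U S) : ℕ → ScheduledState n V R W O U S
  | 0 => σ
  | s + 1 => if roundRobin s ∈ F then A.schedule k F σ s
    else A.step k (roundRobin s) (A.schedule k F σ s)

theorem reaches_schedule [NeZero n] (F : Finset (Fin n)) (σ : ScheduledState n V R W O U S)
    (s : ℕ) : A.Reaches t k σ (A.schedule k F σ s) := by
  induction s with
  | zero => exact .refl
  | succ s ih =>
    rw [schedule]
    split_ifs
    · exact ih
    · exact ih.step _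

theorem move_schedule [NeZero n] (F : Finset (Fin n)) (hσ : A.IsConsistent k σ) (s : ℕ) :
    A.Move t k (label F s) (A.schedule k F σ s) (A.schedule k F σ (s + 1)) := by
  rw [schedule, label]
  split_ifs
  -- The turn of a crashed process is filled with a trivial reassignment.
  · exact .reassign ((reaches_schedule (t := t) F σ s).isConsistent hσ).reassign_refl
  · exact .step _ _

theorem schedule_similar [NeZero n] {F : Finset (Fin n)} (h : Similar F σ τ)
    (hd : σ.dec = τ.dec) (s : ℕ) :
    Similar F (A.schedule k F σ s) (A.schedule k F τ s) ∧
      (A.schedule k F σ s).dec = (A.schedule k F τ s).dec := by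
  induction s with
  | zero => exact ⟨h, hd⟩
  | succ s ih =>
    simp only [schedule]
    split_ifs with hF
    · exact ih
    · have hloc := ih.1.loc _ hF
      exact ⟨similar_step ih.1 hloc, by rw [step_dec, step_dec, hloc, ih.2]⟩

/-- Every reachable state lies on a genuine run: follow the finite path to it, then crash `F` and
let the others take turns. The requirements of consensus, stated for runs, thereby apply to
reachable states. -/
theorem ImplementsConsensus.of_reaches [NeZero n] (hA : A.ImplementsConsensus t k)
    {F : Finset (Fin n)} (hF : F.card ≤ t) (ht : t < n)
    (h : A.Reaches t k (A.scheduledInitial input) σ) :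
    (∃ s v, v ∈ (A.schedule k F σ s).dec) ∧ (∀ v ∈ σ.dec, ∃ j, v = input j) ∧
      ∀ v ∈ σ.dec, ∀ w ∈ σ.dec, v = w := by
  have hσ := h.isConsistent isConsistent_scheduledInitial
  obtain ⟨f, l, N, h0, hm, heq⟩ := h.exists_sequence (f := A.schedule k F σ) rfl (move_schedule F hσ)
  obtain ⟨e, hrun, hdec, hdec'⟩ := exists_isRun hA.one_shot h0 hm hF
    (fun i hi => ⟨N, fun s' hs' => by
      obtain ⟨s, rfl⟩ := Nat.exists_eq_add_of_le' hs'
      rw [(heq s).2, label]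
      split_ifs with hr
      · simp
      · intro h'
        rw [Option.some.injEq] at h'
        exact hr (h' ▸ hi)⟩)
    (fun i hi s => by
      obtain ⟨s', hs', rfl⟩ := exists_roundRobin_eq i s
      exact ⟨s' + N, by omega, by rw [(heq s').2, label, if_neg hi]⟩)
  have hN : f N = σ := by simpa [schedule] using (heq 0).1
  refine ⟨?_, fun v hv => ?_, fun v hv w hw => ?_⟩
  · obtain ⟨i, hi⟩ : ∃ i, i ∉ F := by
      by_contra! hall
      have := Finset.card_le_card (fun i _ => hall i : Finset.univ ⊆ F)
      rw [Finset.card_univ, Fintype.card_fin] at this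
      omega
    obtain ⟨v, hv⟩ := hA.termination _ _ _ _ hrun i hi
    obtain ⟨s, hs⟩ := hdec' i v hv
    refine ⟨s, v, ?_⟩
    rw [← (heq s).1]
    have : ∀ s', s ≤ s' → (f s).dec ⊆ (f s').dec := by
      intro s' hs'
      induction s', hs' using Nat.le_induction with
      | base => exact subset_rfl
      | succ s' _ ih => exact ih.trans (hm s').dec_subset
    exact this _ (by omega) hs
  · rw [← hN] at hv
    obtain ⟨i, hi⟩ := hdec N v hv
    exact hA.validity _ _ _ _ hrun i v hi
  · rw [← hN] at hv hw
    obtain ⟨i, hi⟩ := hdec N v hv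
    obtain ⟨j, hj⟩ := hdec N w hw
    exact hA.agreement _ _ _ _ hrun i j v w hi hj

end Algorithm
end CrashModel

/-! ### The bivalence argument. -/

namespace CrashModel
namespace Algorithm

open ScheduledState

variable {n : ℕ} {V R W O U S : Type*}

/-- The values that can be decided from a state on. -/
def decisions (A : Algorithm n V R W O U S) (t k : ℕ) (σ : ScheduledState n V R W O U S) : Set V :=
  {v | ∃ τ, A.Reaches t k σ τ ∧ v ∈ τ.dec}

variable {A : Algorithm n V R W O U S} {t k : ℕ} {input : Fin n → V}
  {σ τ : ScheduledState n V R W O U S} {p q : Fin n}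

theorem Reaches.decisions_subset (h : A.Reaches t k σ τ) :
    A.decisions t k τ ⊆ A.decisions t k σ := fun _ ⟨ρ, hρ, hv⟩ => ⟨ρ, h.trans hρ, hv⟩

/-- States that differ only for few processes have a possible decision in common. -/
theorem ImplementsConsensus.decisions_inter_nonempty [NeZero n] (hA : A.ImplementsConsensus t k)
    (ht : t < n) {F : Finset (Fin n)} (hF : F.card ≤ t)
    (h : A.Reaches t k (A.scheduledInitial input) σ) (hs : Similar F σ τ) (hd : σ.dec = τ.dec) :
    (A.decisions t k σ ∩ A.decisions t k τ).Nonempty := by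
  obtain ⟨s, v, hv⟩ := (hA.of_reaches hF ht h).1
  exact ⟨v, ⟨_, reaches_schedule F σ s, hv⟩,
    ⟨_, reaches_schedule F τ s, (schedule_similar hs hd s).2 ▸ hv⟩⟩

theorem step_comm_dec (hpq : p ≠ q) :
    (A.step k q (A.step k p σ)).dec = (A.step k p (A.step k q σ)).dec := by
  rw [step_dec, step_dec, step_dec, step_dec, step_loc_of_ne hpq, step_loc_of_ne hpq.symm,
    Set.union_left_comm]

/-- Both sides are similar, up to `q`, to the state where only `p` has stepped. -/
theorem IsPassive.similar_step_comm (h : A.IsPassive q σ) (hpq : p ≠ q) :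
    Similar {q} (A.step k q (A.step k p σ)) (A.step k p (A.step k q σ)) :=
  (h.step hpq.symm).similar.trans (similar_step h.similar (step_loc_of_ne hpq)).symm

open Classical in
theorem step_step_of_invoke (hpq : p ≠ q) {o : O} {u u' : U} {cont cont' : Finset (Fin n × U) → S}
    (hp : A.next p (σ.loc p) = .snapshot o u cont) (hpo : σ.inv o p = none)
    (hq : A.next q (σ.loc q) = .snapshot o u' cont') (hqo : σ.inv o q = none) :
    A.step k q (A.step k p σ) = { σ with
      inv := Function.update σ.inv o
        (Function.update (Function.update (σ.inv o) p (some u)) q (some u'))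
      asg := Function.update σ.asg o
        (assign k (Function.update (Function.update (σ.inv o) p (some u)) q (some u'))
          (assign k (Function.update (σ.inv o) p (some u)) (σ.asg o))) } := by
  rw [step_invoke hp hpo, step_invoke (o := o) (u := u') (cont := cont')]
  · simp
  · exact hq
  · simp [hpq.symm, hqo]

open Classical in
/-- After two processes have invoked the same object, the views can be assigned anew as if both
invocations had happened at the same time. -/
theorem reassign_of_invoke_invoke (ht : 1 ≤ t) (hkt : n ≤ t + k) (hσ : A.IsConsistent k σ)
    (hpq : p ≠ q) {o : O} {u u' : U} {cont cont' : Finset (Fin n × U) → S}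
    (hp : A.next p (σ.loc p) = .snapshot o u cont) (hpo : σ.inv o p = none)
    (hq : A.next q (σ.loc q) = .snapshot o u' cont') (hqo : σ.inv o q = none) :
    Reassign t k (A.step k q (A.step k p σ)) { σ with
      inv := Function.update σ.inv o
        (Function.update (Function.update (σ.inv o) p (some u)) q (some u'))
      asg := Function.update σ.asg o
        (assign k (Function.update (Function.update (σ.inv o) p (some u)) q (some u'))
          (σ.asg o)) } := by
  rw [step_step_of_invoke hpq hp hpo hq hqo]
  refine ⟨rfl, rfl, fun o' => ?_, fun o' i X hX => ?_, ?_⟩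
  · by_cases ho : o' = o
    · subst ho
      simp only [Function.update_self]
      refine (hσ.isAssignment o').assign fun j w hj => ?_
      rw [Function.update_of_ne, Function.update_of_ne]
      · exact hj
      · rintro rfl; simp [hpo] at hj
      · rintro rfl; simp [hqo] at hj
    · simpa [ho] using hσ.isAssignment o'
  · have ha := hσ.view o' i X hX
    by_cases ho : o' = o
    · subst ho
      simpa using assign_of_some ha
    · simpa [ho] using ha
  · obtain ⟨F, hF, h⟩ := (hσ.isAssignment o).exists_assign_assign_eq
      (inv₁ := Function.update (σ.inv o) p (some u))
      (inv₂ := Function.update (Function.update (σ.inv o) p (some u)) q (some u')) p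
      (fun i hi => Function.update_of_ne hi _ _) ht hkt
    refine ⟨F, hF, fun i hi o' => ?_⟩
    by_cases ho : o' = o
    · subst ho
      simpa using h i hi
    · simp [ho]

theorem IsConsistent.reassign_symm (hσ : A.IsConsistent k σ) (h : Reassign t k σ τ) :
    Reassign t k τ σ := by
  obtain ⟨F, hF, h'⟩ := h.asg
  exact ⟨h.glob.symm, h.dec.symm, hσ.isAssignment, hσ.view, F, hF,
    fun i hi o => (h' i hi o).symm⟩

/-- The order of the steps of two processes does not determine the decision. -/
theorem ImplementsConsensus.decisions_step_step [NeZero n] (hA : A.ImplementsConsensus t k)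
    (htn : t < n) (ht : 1 ≤ t) (hkt : n ≤ t + k)
    (h : A.Reaches t k (A.scheduledInitial input) σ) (hpq : p ≠ q) :
    (A.decisions t k (A.step k q (A.step k p σ)) ∩
      A.decisions t k (A.step k p (A.step k q σ))).Nonempty := by
  classical
  have hσ := h.isConsistent isConsistent_scheduledInitial
  have hnonempty : (A.decisions t k (A.step k q (A.step k p σ))).Nonempty := by
    obtain ⟨s, v, hv⟩ := (hA.of_reaches (F := ∅) (by simp) htn ((h.step p).step q)).1
    exact ⟨v, _, reaches_schedule _ _ s, hv⟩
  have hcomm : A.step k q (A.step k p σ) = A.step k p (A.step k q σ) →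
      (A.decisions t k (A.step k q (A.step k p σ)) ∩
        A.decisions t k (A.step k p (A.step k q σ))).Nonempty := by
    intro h
    rw [← h, Set.inter_self]
    exact hnonempty
  by_cases hq : A.IsPassive q σ
  · exact hA.decisions_inter_nonempty htn (F := {q}) (by simpa using ht) ((h.step p).step q)
      (hq.similar_step_comm hpq) (step_comm_dec hpq)
  by_cases hp : A.IsPassive p σ
  · exact hA.decisions_inter_nonempty htn (F := {p}) (by simpa using ht) ((h.step p).step q)
      (hp.similar_step_comm hpq.symm).symm (step_comm_dec hpq)
  rcases not_isPassive hp with ⟨r, w, cont, hp⟩ | ⟨o, u, cont, hp, hpo⟩ <;>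
    rcases not_isPassive hq with ⟨r', w', cont', hq⟩ | ⟨o', u', cont', hq, hqo⟩
  -- Two writes commute since registers are single-writer; the only non-commuting case below is that
  -- of two invocations of the same object.
  · refine hcomm ?_
    rw [step_write hp, step_write hq,
      step_write (r := r') (w := w') (cont := cont') (by simpa [hpq.symm] using hq),
      step_write (r := r) (w := w) (cont := cont) (by simpa [hpq] using hp)]
    congr 2
    · exact Function.update_comm hpq _ _ _
    · by_cases hr : r = r'
      · subst hr
        simp [Function.update_comm hpq]
      · simp [hr, Ne.symm hr, Function.update_comm hr]
  · refine hcomm ?_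
    rw [step_write hp, step_invoke hq hqo,
      step_invoke (o := o') (u := u') (cont := cont') (by simpa [hpq.symm] using hq) (by exact hqo),
      step_write (r := r) (w := w) (cont := cont) (by exact hp)]
  · refine hcomm ?_
    rw [step_invoke hp hpo, step_write hq,
      step_write (r := r') (w := w') (cont := cont') (by exact hq),
      step_invoke (o := o) (u := u) (cont := cont) (by simpa [hpq] using hp) (by exact hpo)]
  · by_cases ho : o = o'
    · subst ho
      have h1 := reassign_of_invoke_invoke (t := t) ht hkt hσ hpq hp hpo hq hqo
      have h2 := reassign_of_invoke_invoke (t := t) ht hkt hσ hpq.symm hq hqo hp hpo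
      rw [Function.update_comm hpq.symm] at h2
      have h3 := (hσ.step (i := q)).step (i := p) |>.reassign_symm h2
      obtain ⟨v, hv⟩ : (A.decisions t k (A.step k p (A.step k q σ))).Nonempty := by
        obtain ⟨s, v, hv⟩ := (hA.of_reaches (F := ∅) (by simp) htn ((h.step q).step p)).1
        exact ⟨v, _, reaches_schedule _ _ s, hv⟩
      -- One order is turned into the other by two reassignments, passing through the simultaneous
      -- invocation.
      have hr : A.Reaches t k (A.step k q (A.step k p σ)) (A.step k p (A.step k q σ)) :=
        (Relation.ReflTransGen.single ⟨_, .reassign h1⟩).tail ⟨_, .reassign h3⟩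
      exact ⟨v, hr.decisions_subset hv, hv⟩
    · refine hcomm ?_
      rw [step_invoke hp hpo, step_invoke hq hqo,
        step_invoke (o := o') (u := u') (cont := cont') (by exact hq) (by simpa [Ne.symm ho] using hqo),
        step_invoke (o := o) (u := u) (cont := cont) (by exact hp) (by simpa [ho] using hpo)]
      simp [ho, Ne.symm ho, Function.update_comm ho]

/-- Reachability by moves other than steps of process `p`. -/
def ReachesWithout (A : Algorithm n V R W O U S) (t k : ℕ) (p : Fin n) :
    ScheduledState n V R W O U S → ScheduledState n V R W O U S → Prop :=
  Relation.ReflTransGen fun σ τ => ∃ l, l ≠ some p ∧ A.Move t k l σ τ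

theorem ReachesWithout.reaches (h : A.ReachesWithout t k p σ τ) : A.Reaches t k σ τ :=
  Relation.ReflTransGen.mono (fun _ _ ⟨l, _, hl⟩ => ⟨l, hl⟩) _ _ h

/-- Splits a path at the first step of `p`. -/
theorem Reaches.without_or (h : A.Reaches t k σ τ) (p : Fin n) :
    A.ReachesWithout t k p σ τ ∨
      ∃ ρ, A.ReachesWithout t k p σ ρ ∧ A.Reaches t k (A.step k p ρ) τ := by
  induction h with
  | refl => exact .inl .refl
  | tail _ h' ih =>
    rcases ih with ih | ⟨ρ, h1, h2⟩
    · obtain ⟨l, hl⟩ := h'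
      by_cases hlp : l = some p
      · subst hlp
        cases hl
        exact .inr ⟨_, ih, .refl⟩
      · exact .inl (ih.tail ⟨l, hlp, hl⟩)
    · exact .inr ⟨ρ, h1, h2.tail h'⟩

/-- Process `p` can take a step, possibly after moves of other processes, that leaves the decision
open. -/
theorem ImplementsConsensus.exists_nontrivial [NeZero n] (hA : A.ImplementsConsensus t k)
    (htn : t < n) (ht : 1 ≤ t) (hkt : n ≤ t + k)
    (h : A.Reaches t k (A.scheduledInitial input) σ) (hσ : (A.decisions t k σ).Nontrivial)
    (p : Fin n) :
    ∃ τ, A.ReachesWithout t k p σ τ ∧ (A.decisions t k (A.step k p τ)).Nontrivial := by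
  by_contra! hcon
  have hsub : ∀ τ, A.ReachesWithout t k p σ τ →
      (A.decisions t k (A.step k p τ)).Subsingleton := hcon
  -- If every step of `p` closed the decision, a single move of the adversary before that step could
  -- not change its outcome.
  have hnext : ∀ τ τ' l, A.ReachesWithout t k p σ τ → l ≠ some p → A.Move t k l τ τ' →
      (A.decisions t k (A.step k p τ) ∩ A.decisions t k (A.step k p τ')).Nonempty := by
    intro τ τ' l hτ hl hm
    have hr : A.Reaches t k (A.scheduledInitial input) τ := h.trans hτ.reaches
    cases hm with
    | step q =>
      have hpq : p ≠ q := by rintro rfl; exact hl rfl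
      refine (hA.decisions_step_step htn ht hkt hr hpq).mono (Set.inter_subset_inter_left _ ?_)
      exact Reaches.decisions_subset (.single ⟨_, .step q _⟩)
    | reassign h' =>
      obtain ⟨F, hF, hs⟩ := h'.exists_similar
      have hloc : τ.loc p = τ'.loc p := by rw [h'.glob]
      exact hA.decisions_inter_nonempty htn hF (hr.step p) (similar_step hs hloc)
        (by rw [step_dec, step_dec, hloc, h'.dec])
  have hall : ∀ τ, A.ReachesWithout t k p σ τ →
      ∀ v ∈ A.decisions t k (A.step k p τ), v ∈ A.decisions t k (A.step k p σ) := by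
    intro τ hτ
    induction hτ with
    | refl => exact fun v hv => hv
    | tail hτ hm ih =>
      obtain ⟨l, hl, hm'⟩ := hm
      intro v hv
      obtain ⟨w, hw, hw'⟩ := hnext _ _ l hτ hl hm'
      rw [hsub _ (hτ.tail ⟨l, hl, hm'⟩) hv hw']
      exact ih w hw
  -- A path from `σ` either contains a first step of `p`, or can be continued by one; in both cases
  -- its decisions are already those after an immediate step of `p`.
  have hle : A.decisions t k σ ⊆ A.decisions t k (A.step k p σ) := by
    rintro v ⟨τ, hτ, hv⟩
    rcases hτ.without_or p with hτ | ⟨ρ, hρ, hρτ⟩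
    · exact hall τ hτ v ⟨_, .refl, (Move.step (t := t) p τ).dec_subset hv⟩
    · exact hall ρ hρ v ⟨τ, hρτ, hv⟩
  exact (Set.not_nontrivial_iff.2 (hsub σ .refl)) (hσ.mono hle)

/-- Some initial state leaves the decision open. -/
theorem ImplementsConsensus.exists_initial_nontrivial [NeZero n] [Nontrivial V]
    (hA : A.ImplementsConsensus t k) (htn : t < n) (ht : 1 ≤ t) :
    ∃ input, (A.decisions t k (A.scheduledInitial input)).Nontrivial := by
  by_contra! hcon
  obtain ⟨x, y, hxy⟩ := exists_pair_ne V
  -- Consecutive inputs differ at one process, which may crash at the start; the two ends are the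
  -- constant inputs `y` and `x`, where validity forces the decision.
  let inp : ℕ → Fin n → V := fun m i => if (i : ℕ) < m then x else y
  have hsub : ∀ m, (A.decisions t k (A.scheduledInitial (inp m))).Subsingleton := fun m =>
    hcon _
  have hstep : ∀ m, m < n → (A.decisions t k (A.scheduledInitial (inp m)) ∩
      A.decisions t k (A.scheduledInitial (inp (m + 1)))).Nonempty := by
    intro m hm
    refine hA.decisions_inter_nonempty htn (F := {⟨m, hm⟩}) (by simpa using ht) .refl
      ⟨rfl, rfl, fun i hi => ?_, fun _ _ _ => rfl, fun _ _ _ => rfl⟩ rfl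
    have him : (i : ℕ) ≠ m := fun h => hi (by simp [← h])
    have : (i : ℕ) ≤ m ↔ (i : ℕ) < m := by omega
    simp [scheduledInitial, initial, inp, this]
  have hall : ∀ m, m ≤ n → ∀ v ∈ A.decisions t k (A.scheduledInitial (inp m)),
      v ∈ A.decisions t k (A.scheduledInitial (inp 0)) := by
    intro m
    induction m with
    | zero => exact fun _ v hv => hv
    | succ m ih =>
      intro hm v hv
      obtain ⟨w, hw, hw'⟩ := hstep m (by omega)
      rw [hsub _ hv hw']
      exact ih (by omega) w hw
  have hval : ∀ m, ∃ v ∈ A.decisions t k (A.scheduledInitial (inp m)), ∃ j, v = inp m j := by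
    intro m
    obtain ⟨s, v, hv⟩ := (hA.of_reaches (F := ∅) (input := inp m) (by simp) htn .refl).1
    have hr := reaches_schedule (A := A) (t := t) (k := k) ∅ (A.scheduledInitial (inp m)) s
    exact ⟨v, ⟨_, hr, hv⟩, (hA.of_reaches (F := ∅) (by simp) htn hr).2.1 v hv⟩
  obtain ⟨v, hv, j, rfl⟩ := hval 0
  obtain ⟨w, hw, j', rfl⟩ := hval n
  have := hsub 0 hv (hall n le_rfl _ hw)
  simp [inp] at this
  exact hxy this.symm

/-- Consensus is impossible if the smallest possible view consists of at most `t` processes. -/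
theorem ImplementsConsensus.false [NeZero n] [Nontrivial V] (hA : A.ImplementsConsensus t k)
    (htn : t < n) (ht : 1 ≤ t) (hkt : n ≤ t + k) : False := by
  obtain ⟨input, hinput⟩ := hA.exists_initial_nontrivial htn ht
  obtain ⟨f, l, h0, hB, hm, hfair⟩ := exists_fair_sequence (A.Move t k)
    {σ | A.Reaches t k (A.scheduledInitial input) σ ∧ (A.decisions t k σ).Nontrivial}
    roundRobin exists_roundRobin_eq (by
      rintro σ ⟨hσ, hσ'⟩ p
      obtain ⟨τ, hτ, hτ'⟩ := hA.exists_nontrivial htn ht hkt hσ hσ' p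
      refine ⟨τ, ?_, _, ⟨Reaches.step (hσ.trans hτ.reaches) p, hτ'⟩, .step p τ⟩
      -- All states on the way to `τ` are bivalent too, since they lead to a bivalent state.
      have hall : ∀ ρ, A.Reaches t k ρ τ → (A.decisions t k ρ).Nontrivial := fun ρ hρ =>
        hτ'.mono (hρ.step p).decisions_subset
      have hreach := hτ.reaches
      clear hτ hσ'
      induction hreach using Relation.ReflTransGen.head_induction_on with
      | refl => exact .refl
      | head hab hb ih =>
        have hb' := hσ.tail hab
        exact .head ⟨⟨hb', hall _ hb⟩, hab⟩ (ih hb'))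
    (A.scheduledInitial input) ⟨.refl, hinput⟩
  obtain ⟨e, hrun, -, hdec⟩ := exists_isRun hA.one_shot h0 hm (F := ∅) (by simp) (by simp)
    (fun i _ => hfair i)
  obtain ⟨v, hv⟩ := hA.termination _ _ _ _ hrun 0 (by simp)
  obtain ⟨s, hs⟩ := hdec 0 v hv
  obtain ⟨hr, w, ⟨τ, hτ, hw⟩, w', ⟨τ', hτ', hw'⟩, hne⟩ := hB s
  -- The value `v` is already decided in `f s`, so it persists in both continuations and must agree
  -- with `w` and with `w'`.
  have h1 := (hA.of_reaches (F := ∅) (by simp) htn (hr.trans hτ)).2.2 v (hτ.dec_subset hs) w hw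
  have h2 := (hA.of_reaches (F := ∅) (by simp) htn (hr.trans hτ')).2.2 v (hτ'.dec_subset hs) w' hw'
  exact hne (h1.symm.trans h2)

end Algorithm
end CrashModel

theorem mainTheorem3 (n t k : ℕ) (hnt : n ≤ 2 * t) (htk : t ≤ k) (hkn : k < n - 1)
    (V R W O U S : Type*) [Nontrivial V] :
    ¬ ∃ A : CrashModel.Algorithm n V R W O U S, A.ImplementsConsensus t k := by
  rintro ⟨A, hA⟩
  have : NeZero n := ⟨by omega⟩
  -- The hypothesis `n ≤ 2 * t` enters through `n ≤ t + k`, that is, `n - k ≤ t`, and through `1 ≤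
  -- t`.
  exact hA.false (by omega) (by omega) (by omega)
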